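/- Let $L$ be a countable first-order language, $T$ a complete $L$-theory, and $\upsilon$ an uncountable (strongly) inaccessible cardinal. Let $\mathcal M$, with universe $M$, be the big model of $T$, i.e. a model of $T$ that is either saturated of cardinality $\upsilon$ or finite. A subset of $M$ is small if it has cardinality $<\upsilon$; write $AB$ for $A\cup B$, let $\operatorname{acl}$ be algebraic closure in $\mathcal M$, and write $A'\equiv_D A$ if $A'$ and $A$ have enumerations with the same type over $D$ in $\mathcal M$. For small $A,B,C\subseteq M$ define: - $A\perp^{a}_C B$ iff $\operatorname{acl}(AC)\cap\operatorname{acl}(BC)=\operatorname{acl}(C)$; - $A\perp^{M}_C B$ iff $A\perp^{a}_D B$ for every $D$ with $C\subseteq D\subseteq\operatorname{acl}(BC)$; - (thorn independence) $A\perp^{\text{þ}}_C B$ iff for every small $E\supseteq BC$ there is $A'\equiv_{BC}A$ with $A'\perp^{M}_C E$; - (exchange independence) $A\perp^{e}_C B$ iff $A\cap\operatorname{acl}(\bar aBC)\subseteq\operatorname{acl}(\bar aC)$ for every finite (possibly empty) tuple $\bar a$ from $A$. $T$ has the exchange property if, for all $a,b\in M$ and $C\subseteq M$, $a\in\operatorname{acl}(C\cup\{b\})\setminus\operatorname{acl}(C)$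 implies $b\in\operatorname{acl}(C\cup\{a\})$. $T$ is real rosy if thorn independence has local character: for every small $A$ there is a cardinal $\kappa<\upsilon$ such that every small $B$ has a subset $C$ with $|C|<\kappa$ and $A\perp^{\text{þ}}_C B$. A ternary relation $\perp$ on small sets has small local character if for all small $A,B,C_0$ with $C_0\subseteq B$ and $|C_0|\le|A|+\aleph_0$ there is $C$ with $C_0\subseteq C\subseteq B$, $|C|\le|A|+\aleph_0$ and $A\perp_C B$. Then: (i) $T$ has the exchange property if and only if $T$ is real rosy and $\perp^{\text{þ}}=\perp^{e}$ (that is, for all small $A,B,C$: $A\perp^{\text{þ}}_C B\iff A\perp^{e}_C B$). (ii) If $T$ has the exchange property, then $\perp^{\text{þ}}$ has small local character. -/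

import Mathlib

open scoped FirstOrder Cardinal

universe u v w

namespace ThornExchange

section

variable (L : FirstOrder.Language.{u, v}) {M : Type w} [L.Structure M]

/-- The algebraic closure of `A` in `M`: all elements that lie in a finite set definable by a
first-order formula with parameters from `A`. -/
def acl (A : Set M) : Set M :=
  {b | ∃ s : Set M, A.Definable₁ L s ∧ s.Finite ∧ b ∈ s}

/-- `A' ≡_D A`: there is an enumeration of `A'`, indexed by the elements of `A`, that satisfies the
same first-order formulas with parameters from `D` as `A` enumerated by itself. -/
def EquivOver (D A' A : Set M) : Prop :=
  ∃ f : A → M, Set.range f = A' ∧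
    ∀ φ : L[[D]].Formula A, φ.Realize f ↔ φ.Realize (fun a : A => (a : M))

/-- `M` is `κ`-saturated: for every `A ⊆ M` with fewer than `κ` elements, every set of formulas in
one variable with parameters from `A` that is finitely satisfiable in `M` is realized in `M`. -/
def IsSaturated (M : Type w) [L.Structure M] (κ : Cardinal.{w}) : Prop :=
  ∀ A : Set M, #A < κ → ∀ p : Set (L[[A]].Formula Unit),
    (∀ q : Set (L[[A]].Formula Unit), q ⊆ p → q.Finite →
      ∃ x : M, ∀ φ ∈ q, φ.Realize (fun _ => x)) →
    ∃ x : M, ∀ φ ∈ p, φ.Realize (fun _ => x)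

/-- A big model of `T`: a saturated model of cardinality `υ`, or a finite model. -/
structure IsBigModel {L : FirstOrder.Language.{u, v}} (T : L.Theory) (υ : Cardinal.{w}) (M : Type w)
    [L.Structure M] : Prop where
  models : M ⊨ T
  saturated_or_finite : (#M = υ ∧ IsSaturated L M υ) ∨ Finite M

/-- A set is small if it has fewer than `υ` elements. -/
def Small (υ : Cardinal.{w}) (A : Set M) : Prop := #A < υ

/-- Algebraic independence of `A` and `B` over `C`. -/
def IndA (A C B : Set M) : Prop :=
  acl L (A ∪ C) ∩ acl L (B ∪ C) = acl L C

/-- The relation obtained from algebraic independence by forcing base monotonicity. -/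
def IndM (A C B : Set M) : Prop :=
  ∀ D : Set M, C ⊆ D → D ⊆ acl L (B ∪ C) → IndA L A D B

/-- Thorn independence of `A` and `B` over `C`. -/
def IndThorn (υ : Cardinal.{w}) (A C B : Set M) : Prop :=
  ∀ E : Set M, Small υ E → B ∪ C ⊆ E → ∃ A' : Set M, EquivOver L (B ∪ C) A' A ∧ IndM L A' C E

/-- Exchange independence of `A` and `B` over `C`. -/
def IndE (A C B : Set M) : Prop :=
  ∀ F : Set M, F.Finite → F ⊆ A → A ∩ acl L (F ∪ B ∪ C) ⊆ acl L (F ∪ C)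

/-- The exchange property for algebraic closure in `M`. -/
def HasExchange (M : Type w) [L.Structure M] : Prop :=
  ∀ (a b : M) (C : Set M), a ∈ acl L (insert b C) → a ∉ acl L C → b ∈ acl L (insert a C)

/-- Local character of a ternary relation (written `ind A C B`) on the small subsets of `M`. -/
def LocalCharacter (υ : Cardinal.{w}) (ind : Set M → Set M → Set M → Prop) : Prop :=
  ∀ A : Set M, Small υ A → ∃ κ < υ, ∀ B : Set M, Small υ B →
    ∃ C : Set M, C ⊆ B ∧ #C < κ ∧ ind A C B

/-- Small local character of a ternary relation (written `ind A C B`) on the small subsets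
of `M`. -/
def SmallLocalCharacter (υ : Cardinal.{w}) (ind : Set M → Set M → Set M → Prop) : Prop :=
  ∀ A B C₀ : Set M, Small υ A → Small υ B → Small υ C₀ → C₀ ⊆ B → #C₀ ≤ #A + ℵ₀ →
    ∃ C : Set M, C₀ ⊆ C ∧ C ⊆ B ∧ #C ≤ #A + ℵ₀ ∧ ind A C B

/-- Real rosiness: thorn independence in the big model `M` has local character. -/
def RealRosy (υ : Cardinal.{w}) (M : Type w) [L.Structure M] : Prop :=
  LocalCharacter υ (IndThorn L υ (M := M))

end

end ThornExchange

namespace ThornExchange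

open FirstOrder.Language Set

/-! ### Solution sets and algebraic closure. -/

section

universe x y

variable {L : FirstOrder.Language.{u, v}} {M : Type w} [L.Structure M] {I : Type x} {J : Type y}

/-! Algebraic closure has finite character and is idempotent, so under exchange it behaves like the
span operator of a matroid. Assume exchange. If `A` is exchange independent from `B` over `C`,
well-order `A` and move it over `BC` entry by entry, so that an entry becomes algebraic over `E` and
its predecessors only if the original was algebraic over `BC` and its own
(`IsSaturated.exists_sameType_free`). Exchange independence lowers `BC` to `C`, and exchange then
gives `IndM` from `E` (`HasExchange.indM_range`). In the other direction, `IndM` from `BC` lets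
elements of `B` be discarded one at a time (`IndM.indE`).

Exchange independence always has small local character, by finite character of `acl`; thorn
independence inherits it, and real rosiness follows. Finally, a failure of exchange yields two
singletons that are exchange independent but, by `IndThorn.mem_acl`, not thorn independent. In a
finite model every algebraic closure is everything, so thorn independence always holds. -/

/-- The solutions in the last variable of a formula whose other variables are assigned by `e`. -/
def solutions (φ : L.Formula (I ⊕ Unit)) (e : I → M) : Set M :=
  {y | φ.Realize (Sum.elim e fun _ => y)}

theorem solutions_relabel (φ : L.Formula (I ⊕ Unit)) (g : I → J) (e : J → M) :
    solutions (φ.relabel (Sum.map g id)) e = solutions φ (e ∘ g) := by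
  ext y
  simp only [solutions, mem_ofPred_eq, Formula.realize_relabel, Sum.elim_comp_map,
    Function.comp_id]

theorem solutions_inf (φ ψ : L.Formula (I ⊕ Unit)) (e : I → M) :
    solutions (φ ⊓ ψ) e = solutions φ e ∩ solutions ψ e := by
  ext y
  simp [solutions]

/-- Having at least `n` solutions is expressible by a formula. -/
theorem exists_formula_solutions (φ : L.Formula (I ⊕ Unit)) (n : ℕ) :
    ∃ ψ : L.Formula I, ∀ e : I → M,
      ψ.Realize e ↔ ∃ y : Fin n → M, Function.Injective y ∧ ∀ i, y i ∈ solutions φ e := by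
  classical
  let distinct : L.Formula (I ⊕ Fin n) :=
    Formula.iInf fun p : {p : Fin n × Fin n // p.1 ≠ p.2} =>
      (((Term.var (Sum.inr p.1.1)).equal (Term.var (Sum.inr p.1.2)) : L.Formula (I ⊕ Fin n))).not
  let solve : L.Formula (I ⊕ Fin n) :=
    Formula.iInf fun i : Fin n => φ.relabel (Sum.map id fun _ => i)
  refine ⟨(distinct ⊓ solve).iExs (Fin n), fun e => ?_⟩
  rw [Formula.realize_iExs]
  refine exists_congr fun y => ?_
  rw [Formula.realize_inf]
  refine and_congr ?_ ?_
  · simp only [distinct, Formula.realize_iInf, Formula.realize_not, Formula.realize_equal,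
      Term.realize_var, Sum.elim_inr, Subtype.forall, Prod.forall]
    exact ⟨fun h i j hij => by_contra fun hne => h i j hne hij, fun h i j hne hij => hne (h hij)⟩
  · simp only [solve, Formula.realize_iInf, Formula.realize_relabel, Sum.elim_comp_map,
      Function.comp_id]
    rfl

/-- Finiteness becomes the failure of some "at least `n` elements" statement, which
`exists_formula_solutions` makes first-order. -/
theorem finite_iff_exists_not_injective_fin {s : Set M} :
    s.Finite ↔ ∃ n : ℕ, ¬ ∃ y : Fin n → M, Function.Injective y ∧ ∀ i, y i ∈ s := by
  constructor
  · intro hs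
    have := hs.to_subtype
    refine ⟨Nat.card s + 1, ?_⟩
    rintro ⟨y, hy, hys⟩
    have := Nat.card_le_card_of_injective (fun i => (⟨y i, hys i⟩ : s))
      fun i j h => hy (congrArg Subtype.val h)
    simp at this
  · rintro ⟨n, hn⟩
    by_contra hs
    have hinf : Infinite s := Set.infinite_coe_iff.2 hs
    obtain ⟨f⟩ : Nonempty (Fin n ↪ s) := ⟨Fin.valEmbedding.trans (Infinite.natEmbedding s)⟩
    exact hn ⟨fun i => f i, Subtype.val_injective.comp f.injective, fun i => (f i).2⟩

/-- Indexing parameters by a tuple rather than a set lets one formula be evaluated at two tuples of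
the same type. -/
theorem mem_acl_range {e : I → M} {b : M} :
    b ∈ acl L (range e) ↔
      ∃ φ : L.Formula (I ⊕ Unit), (solutions φ e).Finite ∧ b ∈ solutions φ e := by
  constructor
  · rintro ⟨s, hs, hfin, hb⟩
    obtain ⟨φ, hφ⟩ := definable_iff_exists_formula_sum.1 hs
    choose g hg using fun a : range e => a.2
    have key : solutions (φ.relabel (Sum.map g fun _ => ())) e = s := by
      ext y
      have h := congrArg (fun t => (fun _ : Fin 1 => y) ∈ t) hφ
      simp only [mem_ofPred_eq, eq_iff_iff] at h
      rw [h]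
      simp only [solutions, mem_ofPred_eq, Formula.realize_relabel, Sum.elim_comp_map]
      have : e ∘ g = Subtype.val := funext hg
      rw [this]
      rfl
    exact ⟨_, key ▸ hfin, key ▸ hb⟩
  · rintro ⟨φ, hfin, hb⟩
    refine ⟨_, definable_iff_exists_formula_sum.2
      ⟨φ.relabel (Sum.map (fun i => ⟨e i, mem_range_self i⟩) fun _ => 0), ?_⟩, hfin, hb⟩
    ext y
    simp only [solutions, mem_ofPred_eq, Formula.realize_relabel, Sum.elim_comp_map]
    rfl

theorem mem_acl {A : Set M} {b : M} :
    b ∈ acl L A ↔ ∃ φ : L.Formula (A ⊕ Unit),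
      (solutions φ ((↑) : A → M)).Finite ∧ b ∈ solutions φ ((↑) : A → M) := by
  simpa using mem_acl_range (L := L) (e := ((↑) : A → M)) (b := b)

variable (L) in
theorem acl_mono {A B : Set M} (h : A ⊆ B) : acl L A ⊆ acl L B :=
  fun _ ⟨s, hs, hfin, hb⟩ => ⟨s, hs.mono h, hfin, hb⟩

variable (L) in
theorem subset_acl (A : Set M) : A ⊆ acl L A := by
  intro a ha
  rw [mem_acl]
  refine ⟨(Term.var (Sum.inr ())).equal (Term.var (Sum.inl ⟨a, ha⟩)), ?_, ?_⟩
  · refine (finite_singleton a).subset fun y hy => ?_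
    simpa [solutions] using hy
  · simp [solutions]

/-- Algebraic closure has finite character. -/
theorem exists_finite_of_mem_acl {A : Set M} {b : M} (h : b ∈ acl L A) :
    ∃ A₀ ⊆ A, A₀.Finite ∧ b ∈ acl L A₀ := by
  obtain ⟨s, hs, hfin, hb⟩ := h
  obtain ⟨A₀, hA₀, hdef⟩ := definable_iff_finitely_definable.1 hs
  exact ⟨A₀, hA₀, A₀.finite_toSet, s, hdef, hfin, hb⟩

/-- Let `φ(c, ·)` have fewer than `n` solutions, `b` among them. Restricting to those of the
finitely many solutions `x` of `θ` for which `φ(x, ·)` also has fewer than `n` solutions gives a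
finite union of finite sets. -/
theorem mem_acl_of_mem_acl_insert {A : Set M} {b c : M} (hc : c ∈ acl L A)
    (hb : b ∈ acl L (insert c A)) : b ∈ acl L A := by
  obtain ⟨θ, hθ, hcθ⟩ := mem_acl.1 hc
  have hrange : insert c A = range (Sum.elim ((↑) : A → M) fun _ : Unit => c) := by
    rw [Sum.elim_range, Subtype.range_coe, range_const, union_singleton]
  rw [hrange, mem_acl_range] at hb
  obtain ⟨φ, hφ, hbφ⟩ := hb
  obtain ⟨n, hn⟩ := finite_iff_exists_not_injective_fin.1 hφ
  obtain ⟨ψ, hψ⟩ := exists_formula_solutions (M := M) φ n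
  rw [← hψ] at hn
  let χ : L.Formula (A ⊕ Unit) :=
    ((θ.relabel (Sum.map (Sum.inl : A → A ⊕ Unit) id) ⊓
      (ψ.relabel (Sum.map (Sum.inl : A → A ⊕ Unit) id)).not) ⊓ φ.relabel
        (Sum.elim (Sum.map (Sum.inl : A → A ⊕ Unit) id) fun _ => Sum.inl (Sum.inr ()))).iExs Unit
  have hχ : ∀ y, y ∈ solutions χ ((↑) : A → M) ↔ ∃ x, x ∈ solutions θ ((↑) : A → M) ∧
      ¬ ψ.Realize (Sum.elim ((↑) : A → M) fun _ => x) ∧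
      y ∈ solutions φ (Sum.elim ((↑) : A → M) fun _ => x) := by
    intro y
    simp only [χ, solutions, mem_ofPred_eq, Formula.realize_iExs, Formula.realize_inf,
      Formula.realize_not, Formula.realize_relabel, Sum.elim_comp_map, Sum.elim_comp_inl,
      Function.comp_id, Sum.comp_elim, and_assoc]
    exact ⟨fun ⟨x, h⟩ => ⟨x (), h⟩, fun ⟨x, h⟩ => ⟨fun _ => x, h⟩⟩
  refine mem_acl.2 ⟨χ, ?_, (hχ b).2 ⟨c, hcθ, hn, hbφ⟩⟩
  refine ((hθ.subset (inter_subset_left (t := {x | ¬ ψ.Realize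
    (Sum.elim ((↑) : A → M) fun _ => x)}))).biUnion (t := fun x =>
      solutions φ (Sum.elim ((↑) : A → M) fun _ => x)) fun x hx => ?_).subset fun y hy => ?_
  · exact finite_iff_exists_not_injective_fin.2 ⟨n, (hψ _).not.1 hx.2⟩
  · obtain ⟨x, hx, hx', hy⟩ := (hχ y).1 hy
    exact mem_biUnion (show x ∈ _ ∩ _ from ⟨hx, hx'⟩) hy

/-- Algebraic closure is idempotent. -/
theorem acl_subset_acl {A B : Set M} (h : B ⊆ acl L A) : acl L B ⊆ acl L A := by
  intro b hb
  obtain ⟨F, hFB, hF, hbF⟩ := exists_finite_of_mem_acl hb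
  have key : ∀ G : Set M, G.Finite → G ⊆ acl L A → acl L (G ∪ A) ⊆ acl L A := by
    intro G hG
    induction G, hG using Set.Finite.induction_on with
    | empty => intro _; rw [empty_union]
    | @insert c G _ _ ih =>
      intro hG x hx
      rw [insert_union] at hx
      have hGA := (subset_insert c G).trans hG
      exact ih hGA (mem_acl_of_mem_acl_insert
        (acl_mono L subset_union_right (hG (mem_insert c G))) hx)
  exact key F hF (hFB.trans h) (acl_mono L subset_union_left hbF)

/-! ### Tuples of the same type. -/

variable (L) in
/-- Two tuples have the same type over the empty set. -/
def SameType (e e' : I → M) : Prop := ∀ φ : L.Formula I, φ.Realize e ↔ φ.Realize e'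

theorem SameType.symm {e e' : I → M} (h : SameType L e e') : SameType L e' e :=
  fun φ => (h φ).symm

theorem SameType.comp {e e' : I → M} (h : SameType L e e') (g : J → I) :
    SameType L (e ∘ g) (e' ∘ g) := fun φ => by
  simpa only [Formula.realize_relabel] using h (φ.relabel g)

theorem SameType.finite_solutions {e e' : I → M} (h : SameType L e e')
    {φ : L.Formula (I ⊕ Unit)} (hφ : (solutions φ e).Finite) : (solutions φ e').Finite := by
  obtain ⟨n, hn⟩ := finite_iff_exists_not_injective_fin.1 hφ
  obtain ⟨ψ, hψ⟩ := exists_formula_solutions (M := M) φ n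
  rw [← hψ, h, hψ] at hn
  exact finite_iff_exists_not_injective_fin.2 ⟨n, hn⟩

theorem SameType.nonempty_solutions {e e' : I → M} (h : SameType L e e')
    {φ : L.Formula (I ⊕ Unit)} (hφ : (solutions φ e).Nonempty) : (solutions φ e').Nonempty := by
  obtain ⟨ψ, hψ⟩ := exists_formula_solutions (M := M) φ 1
  obtain ⟨a, ha⟩ := hφ
  obtain ⟨y, -, hy⟩ :=
    (hψ e').1 ((h ψ).1 ((hψ e).2 ⟨fun _ => a, Function.injective_of_subsingleton _, fun _ => ha⟩))
  exact ⟨y 0, hy 0⟩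

theorem SameType.mem_acl_image {e e' : I → M} (h : SameType L e e') {i : I} {S : Set I}
    (hi : e i ∈ acl L (e '' S)) : e' i ∈ acl L (e' '' S) := by
  rw [image_eq_range, mem_acl_range] at hi ⊢
  obtain ⟨φ, hφ, hφi⟩ := hi
  refine ⟨φ, (h.comp ((↑) : S → I)).finite_solutions hφ, ?_⟩
  have := h.comp (Sum.elim ((↑) : S → I) fun _ : Unit => i) φ
  simp only [Sum.comp_elim] at this
  exact this.1 hφi

/-- Having the same type is a local condition. -/
theorem sameType_of_finset {e e' : I → M}
    (h : ∀ s : Finset I, ∃ (K : Type y) (k k' : K → M), SameType L k k' ∧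
      ∀ i ∈ s, ∃ j, e i = k j ∧ e' i = k' j) : SameType L e e' := by
  classical
  intro φ
  obtain ⟨K, k, k', hk, hs⟩ := h (BoundedFormula.freeVarFinset φ)
  choose g hg hg' using fun i : BoundedFormula.freeVarFinset φ => hs i i.2
  have h1 := BoundedFormula.realize_restrictFreeVar (φ := φ) (f := g) (v := k)
    (xs := default) e fun i => (hg i).symm
  have h2 := BoundedFormula.realize_restrictFreeVar (φ := φ) (f := g) (v := k')
    (xs := default) e' fun i => (hg' i).symm
  exact h1.symm.trans ((hk _).trans h2)

theorem realize_iff_constantsVarsEquiv {D : Set M} (φ : L[[D]].Formula I) (e : I → M) :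
    φ.Realize e ↔ Formula.Realize (BoundedFormula.constantsVarsEquiv φ)
      (Sum.elim ((↑) : D → M) e) :=
  (BoundedFormula.realize_constantsVarsEquiv (φ := φ) (v := e) (xs := default)).symm

theorem forall_realize_iff_sameType {D : Set M} {e e' : I → M} :
    (∀ φ : L[[D]].Formula I, φ.Realize e ↔ φ.Realize e') ↔
      SameType L (Sum.elim ((↑) : D → M) e) (Sum.elim ((↑) : D → M) e') := by
  simp only [realize_iff_constantsVarsEquiv]
  exact ⟨fun h φ => by simpa using h (BoundedFormula.constantsVarsEquiv.symm φ), fun h φ => h _⟩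

/-! ### Saturation and free conjugates. -/

/-- Downward directedness reduces finite satisfiability to the consistency of single formulas. -/
theorem IsSaturated.exists_mem_solutions {κ : Cardinal.{w}} (hM : IsSaturated L M κ) (e : I → M)
    (he : #(range e) < κ) {P : Set (L.Formula (I ⊕ Unit))} (hne : P.Nonempty)
    (hdir : ∀ φ ∈ P, ∀ ψ ∈ P, ∃ χ ∈ P, solutions χ e ⊆ solutions φ e ∩ solutions ψ e)
    (hP : ∀ φ ∈ P, (solutions φ e).Nonempty) : ∃ x, ∀ φ ∈ P, x ∈ solutions φ e := by
  let tr (φ : L.Formula (I ⊕ Unit)) : L[[range e]].Formula Unit :=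
    BoundedFormula.constantsVarsEquiv.symm (φ.relabel (Sum.map (rangeFactorization e) id))
  have htr : ∀ φ x, (tr φ).Realize (fun _ => x) ↔ x ∈ solutions φ e := by
    intro φ x
    rw [realize_iff_constantsVarsEquiv]
    simp only [tr, Equiv.apply_symm_apply]
    rw [Formula.realize_relabel, Sum.elim_comp_map]
    rfl
  obtain ⟨x, hx⟩ := hM (range e) he (tr '' P) fun q hq hfin => by
    have : ∃ χ ∈ P, ∀ φ ∈ q, ∀ x ∈ solutions χ e, φ.Realize fun _ => x := by
      induction q, hfin using Set.Finite.induction_on with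
      | empty => exact ⟨hne.some, hne.some_mem, fun φ h => h.elim⟩
      | @insert θ q _ _ ih =>
        obtain ⟨χ, hχ, hχq⟩ := ih ((subset_insert θ q).trans hq)
        obtain ⟨φ, hφ, rfl⟩ := hq (mem_insert θ q)
        obtain ⟨ρ, hρ, hsub⟩ := hdir χ hχ φ hφ
        refine ⟨ρ, hρ, ?_⟩
        rintro ψ (rfl | hψ) x hx
        · exact (htr φ x).2 (hsub hx).2
        · exact hχq ψ hψ x (hsub hx).1
    obtain ⟨χ, hχ, hq⟩ := this
    obtain ⟨x, hx⟩ := hP χ hχ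
    exact ⟨x, fun φ hφ => hq φ hφ x hx⟩
  exact ⟨x, fun φ hφ => (htr φ x).1 (hx _ (mem_image_of_mem tr hφ))⟩

/-- In a saturated model a type-preserving correspondence of small tuples extends to any further
element, and the image of a nonalgebraic element can be chosen outside the algebraic closure of a
given small set. -/
theorem IsSaturated.exists_extension {κ : Cardinal.{w}} (hM : IsSaturated L M κ) {e e' : I → M}
    (h : SameType L e e') (E : Set M) (hE : #(E ∪ range e' : Set M) < κ) (a : M) :
    ∃ b, SameType L (Sum.elim e fun _ : Unit => a) (Sum.elim e' fun _ : Unit => b) ∧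
      (b ∈ acl L (E ∪ range e') → a ∈ acl L (range e)) := by
  let d : E ⊕ I → M := Sum.elim (↑) e'
  have hd : range d = E ∪ range e' := by simp only [d, Sum.elim_range, Subtype.range_coe]
  let up (φ : L.Formula (I ⊕ Unit)) : L.Formula ((E ⊕ I) ⊕ Unit) := φ.relabel (Sum.map Sum.inr id)
  have hup : ∀ φ, solutions (up φ) d = solutions φ e' := fun φ => solutions_relabel _ _ _
  have hsol : ∀ φ ψ, solutions (up φ ⊓ ψ.not) d = solutions φ e' \ solutions ψ d := by
    intro φ ψ
    rw [solutions_inf, hup]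
    ext y
    simp [solutions]
  -- The last disjunction lets a nonempty finite set be excluded only when `a` is nonalgebraic, so
  -- one type serves both cases.
  let P : Set (L.Formula ((E ⊕ I) ⊕ Unit)) := {χ | ∃ φ ψ, χ = up φ ⊓ ψ.not ∧ a ∈ solutions φ e ∧
    (solutions ψ d).Finite ∧ (solutions ψ d = ∅ ∨ a ∉ acl L (range e))}
  have hbot : solutions (⊥ : L.Formula ((E ⊕ I) ⊕ Unit)) d = ∅ := by
    ext y
    simp [solutions]
  obtain ⟨b, hb⟩ := hM.exists_mem_solutions d (hd ▸ hE) (P := P)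
    ⟨_, ⊤, ⊥, rfl, by simp [solutions], by simp [hbot], Or.inl hbot⟩ (by
      rintro _ ⟨φ, ψ, rfl, hφ, hψ, hψ'⟩ _ ⟨φ', ψ', rfl, hφ', hθ, hθ'⟩
      have hsup : solutions (ψ ⊔ ψ') d = solutions ψ d ∪ solutions ψ' d := by
        ext y
        simp [solutions]
      refine ⟨_, ⟨φ ⊓ φ', ψ ⊔ ψ', rfl, by rw [solutions_inf]; exact ⟨hφ, hφ'⟩,
        hsup ▸ hψ.union hθ, ?_⟩, ?_⟩
      · rw [hsup]
        rcases hψ' with h1 | h1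
        · rcases hθ' with h2 | h2
          · exact Or.inl (by rw [h1, h2, union_empty])
          · exact Or.inr h2
        · exact Or.inr h1
      · rw [hsol, hsol, hsol, solutions_inf, hsup]
        exact fun y hy => ⟨⟨hy.1.1, fun h => hy.2 (Or.inl h)⟩, hy.1.2, fun h => hy.2 (Or.inr h)⟩) (by
      rintro _ ⟨φ, ψ, rfl, hφ, hψ, hψ'⟩
      rw [hsol]
      rcases hψ' with h1 | h1
      · rw [h1, sdiff_empty]
        exact h.nonempty_solutions ⟨a, hφ⟩
      · have hinf : (solutions φ e').Infinite := fun hfin =>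
          h1 (mem_acl_range.2 ⟨φ, h.symm.finite_solutions hfin, hφ⟩)
        exact (hinf.sdiff hψ).nonempty)
  have hreal : ∀ φ : L.Formula (I ⊕ Unit), a ∈ solutions φ e → b ∈ solutions φ e' := by
    intro φ hφ
    have := hb _ ⟨φ, ⊥, rfl, hφ, by simp [hbot], Or.inl hbot⟩
    rw [hsol] at this
    exact this.1
  refine ⟨b, fun φ => ⟨hreal φ, fun hφ => by_contra fun hφ' => ?_⟩, fun hbE => ?_⟩
  · exact Formula.realize_not.1 (hreal φ.not (Formula.realize_not.2 hφ')) hφ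
  · by_contra ha
    rw [← hd, mem_acl_range] at hbE
    obtain ⟨ψ, hψ, hbψ⟩ := hbE
    have := hb _ ⟨⊤, ψ, rfl, by simp [solutions], hψ, Or.inr ha⟩
    rw [hsol] at this
    exact this.2 hbψ

end

section

variable {L : FirstOrder.Language.{u, v}} {M : Type w} [L.Structure M] {I : Type w}
  {υ : Cardinal.{w}}

/-- A small tuple can be moved by a correspondence fixing the type over `D` so that each entry is
as free as possible from `E` over the preceding ones. -/
theorem IsSaturated.exists_sameType_free [LinearOrder I] [WellFoundedLT I]
    (hM : IsSaturated L M υ) (hυ : ℵ₀ ≤ υ) (D E : Set M) (hD : #D < υ) (hE : #E < υ)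
    (hI : #I < υ) (a : I → M) :
    ∃ f : I → M, SameType L (Sum.elim ((↑) : D → M) a) (Sum.elim ((↑) : D → M) f) ∧
      ∀ i, f i ∈ acl L (E ∪ (D ∪ f '' Iio i)) → a i ∈ acl L (D ∪ a '' Iio i) := by
  classical
  let tup (i : I) (g : Iio i → M) : D ⊕ Iio i → M := Sum.elim (↑) g
  let Good (i : I) (g : Iio i → M) (b : M) : Prop :=
    SameType L (Sum.elim (tup i fun j => a j) fun _ : Unit => a i)
        (Sum.elim (tup i g) fun _ : Unit => b) ∧
      (b ∈ acl L (E ∪ range (tup i g)) → a i ∈ acl L (range (tup i fun j => a j)))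
  let step (i : I) (rec : ∀ j, j < i → M) : M :=
    -- The default `a i` is never taken: `hgood` shows that a good `b` always exists.
    if h : ∃ b, Good i (fun j => rec j j.2) b then h.choose else a i
  let f : I → M := wellFounded_lt.fix step
  have hf : ∀ i, (∃ b, Good i (fun j => f j) b) → Good i (fun j => f j) (f i) := by
    intro i h
    have : f i = h.choose := by
      rw [show f i = step i fun j _ => f j from WellFounded.fix_eq _ _ _]
      exact dif_pos h
    rw [this]
    exact h.choose_spec
  have hlocal : ∀ S : Set I, (∀ i ∈ S, Good i (fun j => f j) (f i)) →
      SameType L (Sum.elim ((↑) : D → M) fun i : S => a i)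
        (Sum.elim ((↑) : D → M) fun i : S => f i) := by
    intro S hS
    refine sameType_of_finset fun s => ?_
    -- A finite set of variables lies at or below its largest index `i`, where `Good` already
    -- matches types.
    by_cases hs : ∃ i : S, Sum.inr i ∈ s
    · obtain ⟨i, hi, hmax⟩ := (s.toRight).exists_max_image id
        (by obtain ⟨i, hi⟩ := hs; exact ⟨i, Finset.mem_toRight.2 hi⟩)
      refine ⟨_, _, _, (hS i i.2).1, ?_⟩
      rintro (d | j) hj
      · exact ⟨Sum.inl (Sum.inl d), rfl, rfl⟩
      · rcases (hmax j (Finset.mem_toRight.2 hj)).lt_or_eq with hlt | heq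
        · exact ⟨Sum.inl (Sum.inr ⟨j, hlt⟩), rfl, rfl⟩
        · obtain rfl : j = i := heq
          exact ⟨Sum.inr (), rfl, rfl⟩
    -- The empty type keeps this index type in the universe used by the other case.
    · refine ⟨D ⊕ PEmpty.{w + 1}, Sum.elim (↑) PEmpty.elim, Sum.elim (↑) PEmpty.elim,
        fun φ => Iff.rfl, ?_⟩
      rintro (d | j) hj
      · exact ⟨Sum.inl d, rfl, rfl⟩
      · exact (hs ⟨j, hj⟩).elim
  have hgood : ∀ i, Good i (fun j => f j) (f i) := by
    intro i
    induction i using WellFoundedLT.induction with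
    | ind i ih =>
      refine hf i (hM.exists_extension (hlocal (Iio i) ih) E ?_ (a i))
      have hr : #(range (tup i fun j => f j)) < υ := by
        refine Cardinal.mk_range_le.trans_lt ?_
        rw [Cardinal.mk_sum, Cardinal.lift_id, Cardinal.lift_id]
        exact Cardinal.add_lt_of_lt hυ hD ((Cardinal.mk_set_le _).trans_lt hI)
      exact (Cardinal.mk_union_le _ _).trans_lt (Cardinal.add_lt_of_lt hυ hE hr)
  refine ⟨f, ?_, fun i hi => ?_⟩
  · have h := (hlocal univ fun i _ => hgood i).comp (Sum.map id fun i => ⟨i, mem_univ i⟩)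
    rwa [Sum.elim_comp_map, Sum.elim_comp_map] at h
  · have hr : ∀ g : I → M, range (tup i fun j => g j) = D ∪ g '' Iio i := by
      intro g
      simp only [tup, Sum.elim_range, Subtype.range_coe, image_eq_range]
    have := (hgood i).2
    rw [hr, hr] at this
    exact this hi

theorem SameType.mem_acl_union {D : Set M} {e e' : I → M}
    (h : SameType L (Sum.elim ((↑) : D → M) e) (Sum.elim ((↑) : D → M) e')) {C : Set M}
    (hC : C ⊆ D) {S : Set I} {x : D ⊕ I} (hx : Sum.elim ((↑) : D → M) e x ∈ acl L (e '' S ∪ C)) :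
    Sum.elim ((↑) : D → M) e' x ∈ acl L (e' '' S ∪ C) := by
  have himage : ∀ g : I → M, Sum.elim ((↑) : D → M) g '' (Sum.inr '' S ∪ Sum.inl '' ((↑) ⁻¹' C)) =
      g '' S ∪ C := by
    intro g
    rw [image_union, image_image, image_image]
    simp only [Sum.elim_inr, Sum.elim_inl, Subtype.image_preimage_coe, inter_eq_right.2 hC]
  rw [← himage] at hx ⊢
  exact h.mem_acl_image hx

/-! ### Exchange, exchange independence and thorn independence. -/

/-- Only finitely many entries of `f` are needed, and their indices have a maximum. -/
theorem mem_acl_or_exists_mem_acl_Iic [LinearOrder I] {f : I → M} {S : Set I} {D : Set M} {b : M}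
    (hb : b ∈ acl L (f '' S ∪ D)) : b ∈ acl L D ∨ ∃ i ∈ S, b ∈ acl L (f '' Iic i ∪ D) := by
  obtain ⟨F, hF, hfin, hbF⟩ := exists_finite_of_mem_acl hb
  obtain ⟨S₀, hS₀, hS₀fin, himage⟩ := exists_subset_image_finite_and (p := (F ∩ f '' S = ·)) |>.1
    ⟨_, inter_subset_right, hfin.inter_of_left (f '' S), rfl⟩
  have hsub : F ⊆ f '' S₀ ∪ D := fun x hx => (hF hx).imp (fun h => himage ▸ ⟨hx, h⟩) id
  rcases S₀.eq_empty_or_nonempty with rfl | hne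
  · rw [image_empty, empty_union] at hsub
    exact Or.inl (acl_mono L hsub hbF)
  · obtain ⟨i, hi, hmax⟩ := S₀.exists_max_image id hS₀fin hne
    exact Or.inr ⟨i, hS₀ hi, acl_mono L (hsub.trans
      (union_subset_union_left _ (image_mono fun j hj => hmax j hj))) hbF⟩

/-- Under exchange, a tuple each of whose entries is algebraic over `E` and the preceding ones only
if it is so over `C` and the preceding ones is independent from `E` over all of `acl E`. -/
theorem HasExchange.indM_range [LinearOrder I] [WellFoundedLT I] (hexch : HasExchange L M)
    {f : I → M} {C E : Set M} (hCE : C ⊆ E)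
    (hf : ∀ i, f i ∈ acl L (f '' Iio i ∪ E) → f i ∈ acl L (f '' Iio i ∪ C)) :
    IndM L (range f) C E := by
  intro D hCD hDE
  rw [union_eq_left.2 hCE] at hDE
  refine Subset.antisymm ?_
    (subset_inter (acl_mono L subset_union_right) (acl_mono L subset_union_right))
  rintro b ⟨hb, hbE⟩
  replace hbE : b ∈ acl L E := acl_subset_acl (union_subset (subset_acl L E) hDE) hbE
  have key : ∀ i, b ∈ acl L (f '' Iic i ∪ D) → b ∈ acl L D := by
    intro i
    induction i using WellFoundedLT.induction with
    | ind i ih =>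
      intro hi
      suffices h : b ∈ acl L (f '' Iio i ∪ D) by
        rcases mem_acl_or_exists_mem_acl_Iic h with h | ⟨j, hj, h⟩
        · exact h
        · exact ih j hj h
      -- If `f i` were needed, exchange would make it algebraic over `E` and its predecessors, hence
      -- by `hf` over `C` and its predecessors, so it could be dropped.
      by_contra hlt
      rw [← Iio_insert, image_insert_eq, insert_union] at hi
      have h₁ : f i ∈ acl L (f '' Iio i ∪ E) := by
        refine acl_subset_acl (insert_subset ?_ (union_subset ?_ ?_)) (hexch _ _ _ hi hlt)
        · exact acl_mono L subset_union_right hbE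
        · exact subset_union_left.trans (subset_acl L _)
        · exact hDE.trans (acl_mono L subset_union_right)
      exact hlt (mem_acl_of_mem_acl_insert
        (acl_mono L (union_subset_union_right _ hCD) (hf i h₁)) hi)
  rw [← image_univ] at hb
  rcases mem_acl_or_exists_mem_acl_Iic hb with h | ⟨i, -, h⟩
  · exact h
  · exact key i h

/-- Finite character replaces the finite tuple of the definition by any subset of `A`, such as an
infinite initial segment. -/
theorem IndE.mem_acl {A B C S : Set M} {a : M} (h : IndE L A C B) (ha : a ∈ A) (hS : S ⊆ A)
    (haS : a ∈ acl L (S ∪ (B ∪ C))) : a ∈ acl L (S ∪ C) := by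
  obtain ⟨F, hF, hfin, haF⟩ := exists_finite_of_mem_acl haS
  have hsub : F ⊆ (F ∩ S) ∪ B ∪ C := fun x hx => by
    rcases hF hx with hS | hB | hC
    exacts [Or.inl (Or.inl ⟨hx, hS⟩), Or.inl (Or.inr hB), Or.inr hC]
  exact acl_mono L (union_subset_union_left _ inter_subset_right)
    (h (F ∩ S) (hfin.inter_of_left S) (inter_subset_right.trans hS) ⟨ha, acl_mono L hsub haF⟩)

theorem IndE.indThorn (hexch : HasExchange L M) (hM : IsSaturated L M υ) (hυ : ℵ₀ ≤ υ)
    {A B C : Set M} (hA : Small υ A) (hB : Small υ B) (hC : Small υ C) (h : IndE L A C B) :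
    IndThorn L υ A C B := by
  intro E hE hBC
  obtain ⟨_, _⟩ := exists_wellFoundedLT A
  have hD : #(B ∪ C : Set M) < υ :=
    (Cardinal.mk_union_le _ _).trans_lt (Cardinal.add_lt_of_lt hυ hB hC)
  obtain ⟨f, hf, hfree⟩ := hM.exists_sameType_free hυ (B ∪ C) E hD hE hA ((↑) : A → M)
  refine ⟨range f, ⟨f, rfl, fun φ => (forall_realize_iff_sameType.2 hf φ).symm⟩,
    hexch.indM_range (subset_union_right.trans hBC) fun i hi => ?_⟩
  have h₁ := hfree i (acl_mono L (union_subset (subset_union_right.trans subset_union_right)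
    subset_union_left) hi)
  rw [union_comm] at h₁
  exact hf.mem_acl_union (x := Sum.inr i) subset_union_right
    (h.mem_acl i.2 (Subtype.coe_image_subset A _) h₁)

theorem IndM.indE (hexch : HasExchange L M) {A B C : Set M} (h : IndM L A C (B ∪ C)) :
    IndE L A C B := by
  rintro F - hFA a ⟨haA, ha⟩
  rw [union_right_comm] at ha
  obtain ⟨B₀, hB₀, hfin, haB₀⟩ : ∃ B₀ ⊆ B, B₀.Finite ∧ a ∈ acl L (B₀ ∪ (F ∪ C)) := by
    obtain ⟨G, hG, hfin, haG⟩ := exists_finite_of_mem_acl ha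
    refine ⟨G ∩ B, inter_subset_right, hfin.inter_of_left B, acl_mono L (fun x hx => ?_) haG⟩
    exact (hG hx).symm.imp (fun h => ⟨hx, h⟩) id
  induction B₀, hfin using Set.Finite.induction_on with
  | empty => rwa [empty_union] at haB₀
  | @insert b G _ _ ih =>
    have hGB := (subset_insert b G).trans hB₀
    have hbB : b ∈ B := hB₀ (mem_insert b G)
    refine ih hGB (by_contra fun hlt => ?_)
    rw [insert_union] at haB₀
    -- Exchange puts `b` in `acl (A ∪ G ∪ C)`; this uses `IndM` at the enlarged base `G ∪ C`.
    have hb : b ∈ acl L (G ∪ C) := by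
      rw [← h (G ∪ C) subset_union_right (union_subset
        (hGB.trans (subset_union_left.trans (subset_union_left.trans (subset_acl L _))))
        (subset_union_right.trans (subset_acl L _)))]
      refine ⟨acl_mono L ?_ (hexch _ _ _ haB₀ hlt), subset_acl L _ (Or.inl (Or.inl hbB))⟩
      refine insert_subset (Or.inl haA) (union_subset ?_ (union_subset ?_ ?_))
      · exact subset_union_left.trans subset_union_right
      · exact hFA.trans subset_union_left
      · exact subset_union_right.trans subset_union_right
    exact hlt (mem_acl_of_mem_acl_insert
      (acl_mono L (union_subset_union_right _ subset_union_right) hb) haB₀)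

theorem EquivOver.indE {A A' B C : Set M} (hA : EquivOver L (B ∪ C) A' A) (h : IndE L A' C B) :
    IndE L A C B := by
  obtain ⟨f, rfl, hf⟩ := hA
  have hf := forall_realize_iff_sameType.1 hf
  rintro F - hFA a ⟨haA, ha⟩
  have himage : ((↑) : A → M) '' ((↑) ⁻¹' F) = F := by
    rw [Subtype.image_preimage_coe, inter_eq_right.2 hFA]
  rw [union_assoc, ← himage] at ha
  have h₁ := hf.symm.mem_acl_union (x := Sum.inr ⟨a, haA⟩) Subset.rfl ha
  have h₂ := hf.mem_acl_union (x := Sum.inr ⟨a, haA⟩) subset_union_right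
    (h.mem_acl (mem_range_self _) (image_subset_range _ _) h₁)
  rwa [himage] at h₂

theorem Small.union {A B : Set M} (hυ : ℵ₀ ≤ υ) (hA : Small υ A) (hB : Small υ B) :
    Small υ (A ∪ B) :=
  (Cardinal.mk_union_le _ _).trans_lt (Cardinal.add_lt_of_lt hυ hA hB)

theorem IndThorn.indE (hexch : HasExchange L M) (hυ : ℵ₀ ≤ υ) {A B C : Set M} (hB : Small υ B)
    (hC : Small υ C) (h : IndThorn L υ A C B) : IndE L A C B := by
  obtain ⟨A', hA', hind⟩ := h (B ∪ C) (hB.union hυ hC) Subset.rfl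
  exact hA'.indE (hind.indE hexch)

/-- Thorn independence is anti-reflexive: nothing nonalgebraic is shared by both sides. -/
theorem IndThorn.mem_acl (hυ : ℵ₀ ≤ υ) {A B C : Set M} (hB : Small υ B) (hC : Small υ C)
    (h : IndThorn L υ A C B) {b : M} (hb : b ∈ B) (hbA : b ∈ acl L (A ∪ C)) : b ∈ acl L C := by
  obtain ⟨_, ⟨f, rfl, hf⟩, hind⟩ := h (B ∪ C) (hB.union hυ hC) Subset.rfl
  rw [← hind C Subset.rfl (subset_union_right.trans (subset_acl L _))]
  refine ⟨?_, subset_acl L _ (Or.inl (Or.inl hb))⟩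
  -- The correspondence fixes `b`, so `b` is also algebraic over `C` and the moved copy of `A`.
  have h₁ := (forall_realize_iff_sameType.1 hf).symm.mem_acl_union (S := univ)
    (x := Sum.inl ⟨b, Or.inl hb⟩) (C := C) subset_union_right
    (by rwa [image_univ, Subtype.range_coe])
  rwa [image_univ] at h₁

/-! ### Recovering exchange. -/

theorem hasExchange_of_indE_imp_indThorn (hυ : ℵ₀ ≤ υ)
    (h : ∀ A B C : Set M, Small υ A → Small υ B → Small υ C → IndE L A C B → IndThorn L υ A C B) :
    HasExchange L M := by
  have hsmall : ∀ F : Set M, F.Finite → Small υ F := fun F hF =>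
    (Cardinal.lt_aleph0_iff_set_finite.2 hF).trans_le hυ
  intro a b C ha haC
  obtain ⟨F, hF, hfin, haF⟩ := exists_finite_of_mem_acl ha
  -- `C` need not be small, but the finite part carrying the dependence is.
  let G := F ∩ C
  have hG : G.Finite := hfin.inter_of_left C
  have haG : a ∈ acl L ({b} ∪ G) :=
    acl_mono L (fun x hx => (hF hx).imp (fun h => h) fun h => ⟨hx, h⟩) haF
  by_contra hb
  refine haC (acl_mono L inter_subset_right ((h {b} {a} G (hsmall _ (finite_singleton b))
    (hsmall _ (finite_singleton a)) (hsmall _ hG) ?_).mem_acl hυ (hsmall _ (finite_singleton a))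
      (hsmall _ hG) rfl haG))
  rintro S - hS _ ⟨rfl, hx⟩
  -- For the empty tuple the assumed failure of exchange applies; for `{b}` the conclusion is
  -- trivial.
  rcases subset_singleton_iff_eq.1 hS with rfl | rfl
  · refine (hb (acl_mono L ?_ hx)).elim
    rw [empty_union, insert_eq]
    exact union_subset_union_right _ inter_subset_right
  · exact subset_acl L _ (Or.inl rfl)

/-! ### Local character. -/

/-- Each pair of a finite subset of `A` and an element of `A` needs only finitely many witnesses
from `B`, and there are at most `#A + ℵ₀` pairs. -/
theorem smallLocalCharacter_indE : SmallLocalCharacter υ (IndE L (M := M)) := by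
  intro A B C₀ _ _ _ hC₀ hcard
  have hex : ∀ p : Finset A × A, ∃ G : Set M, G ⊆ B ∧ G.Finite ∧
      ((p.2 : M) ∈ acl L ((↑) '' (p.1 : Set A) ∪ B) →
        (p.2 : M) ∈ acl L ((↑) '' (p.1 : Set A) ∪ G)) := by
    intro p
    by_cases hp : (p.2 : M) ∈ acl L ((↑) '' (p.1 : Set A) ∪ B)
    · obtain ⟨F, hF, hfin, h⟩ := exists_finite_of_mem_acl hp
      exact ⟨F ∩ B, inter_subset_right, hfin.inter_of_left B, fun _ =>
        acl_mono L (fun x hx => (hF hx).imp id fun h => ⟨hx, h⟩) h⟩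
    · exact ⟨∅, empty_subset _, finite_empty, fun h => (hp h).elim⟩
  choose G hGB hGfin hG using hex
  refine ⟨C₀ ∪ ⋃ p, G p, subset_union_left, union_subset hC₀ (iUnion_subset hGB), ?_, ?_⟩
  · have hle : ℵ₀ ≤ #A + ℵ₀ := self_le_add_left _ _
    have hfinset : #(Finset A) ≤ #A + ℵ₀ := by
      rcases finite_or_infinite A with hA | hA
      · exact (Cardinal.lt_aleph0_of_finite _).le.trans hle
      · rw [Cardinal.mk_finset_of_infinite]
        exact self_le_add_right _ _
    have hprod : #(Finset A × A) ≤ #A + ℵ₀ := by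
      rw [Cardinal.mk_prod, Cardinal.lift_id, Cardinal.lift_id]
      exact Cardinal.mul_le_of_le hle hfinset (self_le_add_right _ _)
    refine (Cardinal.mk_union_le _ _).trans (Cardinal.add_le_of_le hle hcard ?_)
    refine (Cardinal.mk_iUnion_le _).trans (Cardinal.mul_le_of_le hle hprod ?_)
    exact ciSup_le' fun p => ((Cardinal.lt_aleph0_iff_set_finite.2 (hGfin p)).le).trans hle
  · rintro F hF hFA a ⟨haA, ha⟩
    have hF' : (((↑) : A → M) ⁻¹' F).Finite := hF.preimage Subtype.val_injective.injOn
    have himage : ((↑) : A → M) '' (hF'.toFinset : Set A) = F := by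
      rw [Finite.coe_toFinset, Subtype.image_preimage_coe, inter_eq_right.2 hFA]
    have h := hG (hF'.toFinset, ⟨a, haA⟩)
    rw [himage] at h
    refine acl_mono L (union_subset_union_right _ ?_) (h (acl_mono L ?_ ha))
    · exact (subset_iUnion G _).trans subset_union_right
    · exact union_subset Subset.rfl ((union_subset hC₀ (iUnion_subset hGB)).trans subset_union_right)

theorem SmallLocalCharacter.localCharacter (hυ : υ.IsInaccessible)
    {ind : Set M → Set M → Set M → Prop} (h : SmallLocalCharacter υ ind) : LocalCharacter υ ind := by
  intro A hA
  -- The successor turns the bound `≤ #A + ℵ₀` into a strict one, and stays below the limit cardinal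
  -- `υ`.
  refine ⟨Order.succ (#A + ℵ₀), hυ.isSuccLimit.succ_lt
    (Cardinal.add_lt_of_lt hυ.aleph0_lt.le hA hυ.aleph0_lt), fun B hB => ?_⟩
  obtain ⟨C, -, hCB, hC, hind⟩ := h A B ∅ hA hB (by simpa [Small] using hυ.pos) (empty_subset B)
    (by simp)
  exact ⟨C, hCB, Order.lt_succ_of_le hC, hind⟩

/-! ### Finite models. -/

theorem acl_eq_univ_of_finite [Finite M] (A : Set M) : acl L A = univ :=
  eq_univ_of_forall fun b => ⟨univ, by simp [Definable₁], finite_univ, mem_univ b⟩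

theorem indThorn_of_finite [Finite M] (A B C : Set M) : IndThorn L υ A C B :=
  fun _ _ _ => ⟨A, ⟨(↑), Subtype.range_coe, fun _ => Iff.rfl⟩, fun _ _ _ => by
    simp only [IndA, acl_eq_univ_of_finite, inter_self]⟩

end

end ThornExchange

theorem mainTheorem5 {L : FirstOrder.Language.{u, v}} (hL : L.card ≤ ℵ₀)
    (T : L.Theory) (hT : T.IsComplete)
    (υ : Cardinal.{w}) (hυ : υ.IsInaccessible)
    (M : Type w) [L.Structure M] [Nonempty M] (hM : ThornExchange.IsBigModel T υ M) :
    (ThornExchange.HasExchange L M ↔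
      (ThornExchange.RealRosy L υ M ∧
        ∀ A B C : Set M, ThornExchange.Small υ A → ThornExchange.Small υ B →
          ThornExchange.Small υ C →
          (ThornExchange.IndThorn L υ A C B ↔ ThornExchange.IndE L A C B))) ∧
    (ThornExchange.HasExchange L M →
      ThornExchange.SmallLocalCharacter υ (ThornExchange.IndThorn L υ (M := M))) := by
  have hυ₀ := hυ.aleph0_lt.le
  have hforward : ThornExchange.HasExchange L M →
      (∀ A B C : Set M, ThornExchange.Small υ A → ThornExchange.Small υ B →
        ThornExchange.Small υ C →
        (ThornExchange.IndThorn L υ A C B ↔ ThornExchange.IndE L A C B)) := by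
    intro hexch A B C hA hB hC
    refine ⟨fun h => h.indE hexch hυ₀ hB hC, fun h => ?_⟩
    rcases hM.saturated_or_finite with ⟨-, hsat⟩ | hfin
    · exact h.indThorn hexch hsat hυ₀ hA hB hC
    · exact ThornExchange.indThorn_of_finite A B C
  have hlocal : ThornExchange.HasExchange L M →
      ThornExchange.SmallLocalCharacter υ (ThornExchange.IndThorn L υ (M := M)) := by
    intro hexch A B C₀ hA hB hC₀ hsub hcard
    obtain ⟨C, hC₀C, hCB, hC, hind⟩ :=
      ThornExchange.smallLocalCharacter_indE (L := L) A B C₀ hA hB hC₀ hsub hcard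
    exact ⟨C, hC₀C, hCB, hC, (hforward hexch A B C hA hB
      ((Cardinal.mk_le_mk_of_subset hCB).trans_lt hB)).2 hind⟩
  refine ⟨⟨fun hexch => ⟨(hlocal hexch).localCharacter hυ, hforward hexch⟩, fun h => ?_⟩, hlocal⟩
  exact ThornExchange.hasExchange_of_indE_imp_indThorn hυ₀
    fun A B C hA hB hC => (h.2 A B C hA hB hC).2
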